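/- Let $\mathcal{G}$ be a Grothendieck category with a chosen set of generators $\{G_s\}_{s\in S}$, and put $G=\bigoplus_{s\in S}G_s$. A short exact sequence $A\rightarrowtail B\twoheadrightarrow C$ in $\mathcal{G}$ is called $G$-exact if $0\to\operatorname{Hom}(G,A)\to\operatorname{Hom}(G,B)\to\operatorname{Hom}(G,C)\to 0$ is a short exact sequence of abelian groups. Let $\mathrm{Ch}(\mathcal{G})_G$ be the category of $\mathbb{Z}$-indexed complexes $\cdots\to X^n\xrightarrow{d^n}X^{n+1}\to\cdots$ in $\mathcal{G}$, with the exact structure given by the short exact sequences of complexes that are $G$-exact in every degree. An inflation is the first map of such a sequence; $\operatorname{Ext}^1$ denotes the Yoneda $\operatorname{Ext}^1$ with respect to this exact structure, and for a class $\mathcal{X}$ of complexes $$\mathcal{X}^{\perp}=\{Y\mid \operatorname{Ext}^1(X,Y)=0\ \ \forall X\in\mathcal{X}\},\qquad {}^{\perp}\mathcal{X}=\{Y\mid \operatorname{Ext}^1(Y,X)=0\ \ \forall X\in\mathcal{X}\}.$$ For an object $A$ of $\mathcal{G}$ and $n\in\mathbb{Z}$, let $S_n(A)$ be the complex with $A$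 in degree $n$ and zero elsewhere, and let $D_n(A)$ be the complex with $A$ in degrees $n$ and $n+1$, zero elsewhere, and $d^n=\mathrm{id}_A$. Let $\mathcal{S}_G=\{D_n(G_s),S_n(G_s)\mid s\in S,\ n\in\mathbb{Z}\}$. A complex $X$ is called $\mathcal{S}_G$-filtered if $0\to X$ is the transfinite composition of a sequence $0=X_0\to X_1\to\cdots\to X_\alpha\to\cdots$ $(\alpha<\lambda)$, indexed by an ordinal $\lambda$ and continuous at limit ordinals, in which every $X_\alpha\to X_{\alpha+1}$ is an inflation with cokernel isomorphic to an object of $\mathcal{S}_G$. Then: (a) $({}^{\perp}(\mathcal{S}_G^{\perp}),\mathcal{S}_G^{\perp})$ is a complete cotorsion pair in $\mathrm{Ch}(\mathcal{G})_G$. That is, with $\mathcal{X}={}^{\perp}(\mathcal{S}_G^{\perp})$ and $\mathcal{Y}=\mathcal{S}_G^{\perp}$ one has $\mathcal{X}={}^{\perp}\mathcal{Y}$ and $\mathcal{Y}=\mathcal{X}^{\perp}$, and every complex $B$ admits degreewise $G$-exact sequences $Y\rightarrowtail X\twoheadrightarrow B$ and $B\rightarrowtail Y'\twoheadrightarrow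 X'$ with $X,X'\in\mathcal{X}$ and $Y,Y'\in\mathcal{Y}$. (b) The objects of ${}^{\perp}(\mathcal{S}_G^{\perp})$ are precisely the direct summands of $\mathcal{S}_G$-filtered complexes. -/

import Mathlib

open CategoryTheory CategoryTheory.Limits Opposite ZeroObject

universe v u

noncomputable section

namespace RelativeCotorsion

section Exact

/- `E` is the class of short exact sequences (conflations) of an exact structure on `A`;
all notions below are taken relative to `E`. -/
variable {A : Type u} [Category.{v} A] [Abelian A] (E : ObjectProperty (ShortComplex A))

/-- A short exact sequence `Y ↣ M ↠ X` in `E`. -/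
structure YonedaExtension (X Y : A) where
  /-- the middle term -/
  M : A
  /-- the inflation -/
  i : Y ⟶ M
  /-- the deflation -/
  p : M ⟶ X
  zero : i ≫ p = 0
  exact : E (ShortComplex.mk i p zero)

/-- Equivalence of extensions: an isomorphism of the middle terms which induces the identity
on both ends. -/
def YonedaExtension.setoid (X Y : A) : Setoid (YonedaExtension E X Y) where
  r e₁ e₂ := ∃ φ : e₁.M ≅ e₂.M, e₁.i ≫ φ.hom = e₂.i ∧ φ.hom ≫ e₂.p = e₁.p
  iseqv :=
    { refl := fun e => ⟨Iso.refl _, by simp, by simp⟩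
      symm := fun ⟨φ, h₁, h₂⟩ => ⟨φ.symm, by simp [← h₁], by simp [← h₂]⟩
      trans := fun ⟨φ, h₁, h₂⟩ ⟨ψ, h₃, h₄⟩ =>
        ⟨φ ≪≫ ψ, by simp [reassoc_of% h₁, h₃], by simp [h₂, h₄]⟩ }

/-- Yoneda `Ext¹(X, Y)` of the exact category `(A, E)`: the equivalence classes of short exact
sequences `Y ↣ M ↠ X` in `E`. For an exact structure it is an abelian group whose zero is the
class of the split sequence, so it vanishes exactly when it has at most one element. -/
def YonedaExt (X Y : A) : Type (max u v) := Quotient (YonedaExtension.setoid E X Y)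

/-- `𝒮^⊥`: the objects `Y` with `Ext¹(X, Y) = 0` for all `X` in `𝒮`. -/
def rightPerp (S : ObjectProperty A) : ObjectProperty A :=
  fun Y => ∀ X, S X → Subsingleton (YonedaExt E X Y)

/-- `^⊥𝒮`: the objects `X` with `Ext¹(X, Y) = 0` for all `Y` in `𝒮`. -/
def leftPerp (S : ObjectProperty A) : ObjectProperty A :=
  fun X => ∀ Y, S Y → Subsingleton (YonedaExt E X Y)

/-- Complete cotorsion pairs `(𝒳, 𝒴)` in the exact category `(A, E)`. -/
structure IsCompleteCotorsionPair (𝒳 𝒴 : ObjectProperty A) : Prop where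
  left_eq : 𝒳 = leftPerp E 𝒴
  right_eq : 𝒴 = rightPerp E 𝒳
  /-- every `B` admits a short exact sequence `Y ↣ X ↠ B` -/
  enoughProjectives : ∀ B : A, ∃ (Y X : A) (i : Y ⟶ X) (p : X ⟶ B) (w : i ≫ p = 0),
    𝒳 X ∧ 𝒴 Y ∧ E (ShortComplex.mk i p w)
  /-- every `B` admits a short exact sequence `B ↣ Y ↠ X` -/
  enoughInjectives : ∀ B : A, ∃ (Y X : A) (i : B ⟶ Y) (p : Y ⟶ X) (w : i ≫ p = 0),
    𝒳 X ∧ 𝒴 Y ∧ E (ShortComplex.mk i p w)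

/-- The inflations which have a cokernel in `S`. -/
def inflationsWithCokernelIn (S : ObjectProperty A) : MorphismProperty A :=
  fun _ Y i => ∃ (Z : A) (p : Y ⟶ Z) (w : i ≫ p = 0), S Z ∧ E (ShortComplex.mk i p w)

/-- The `S`-filtered objects: those `X` for which `0 ⟶ X` is a transfinite composition (indexed
by a small well-ordered set) of inflations with a cokernel in `S`. -/
def filtered (S : ObjectProperty A) : ObjectProperty A :=
  fun X => MorphismProperty.transfiniteCompositions.{v} (inflationsWithCokernelIn E S)
    (0 : (0 : A) ⟶ X)

/-- The direct summands of the objects in `P`. -/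
def directSummands (P : ObjectProperty A) : ObjectProperty A :=
  fun X => ∃ F W : A, P F ∧ Nonempty (F ≅ X ⊞ W)

end Exact

section Complexes

variable {C : Type u} [Category.{v} C] [Abelian C]

/-- The `G`-exact sequences: short exact sequences which stay short exact under `Hom(G, -)`. -/
def gExact (G : C) : ObjectProperty (ShortComplex C) :=
  fun T => T.ShortExact ∧ (T.map (preadditiveCoyoneda.obj (op G))).ShortExact

/-- The degreewise `G`-exact sequences of complexes. -/
def degreewiseGExact (G : C) : ObjectProperty (ShortComplex (CochainComplex C ℤ)) :=
  fun T => T.ShortExact ∧ ∀ n : ℤ,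
    gExact G (T.map (HomologicalComplex.eval C (ComplexShape.up ℤ) n))

/-- The sphere `S_n(M)`: the object `M` in degree `n`, and zero elsewhere. -/
def sphere (n : ℤ) (M : C) : CochainComplex C ℤ :=
  (HomologicalComplex.single C (ComplexShape.up ℤ) n).obj M

/-- The disk `D_n(M)`: the identity of `M` from degree `n` to degree `n + 1`, and zero
elsewhere. -/
def disk (n : ℤ) (M : C) : CochainComplex C ℤ :=
  HomologicalComplex.double (𝟙 M) (show (ComplexShape.up ℤ).Rel n (n + 1) from rfl)

/-- The set of all disks `D_n(G_s)` and spheres `S_n(G_s)`, where `n` is an integer. -/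
inductive disksAndSpheres {ι : Type v} (G : ι → C) : ObjectProperty (CochainComplex C ℤ)
  | disk (n : ℤ) (s : ι) : disksAndSpheres G (disk n (G s))
  | sphere (n : ℤ) (s : ι) : disksAndSpheres G (sphere n (G s))

end Complexes

end RelativeCotorsion

end

/-! Let I be the set of inclusions S_{n+1}(G_s) → D_n(G_s). Pushing such an inclusion out along a
cycle z of Y gives an extension of S_n(G_s) by Y, and if it splits then z is a boundary. Hence the
right orthogonal of the disks and spheres consists of the complexes Y with every Hom(G_s, Y) acyclic
(`rightPerp_disksAndSpheres_iff`). Lifting against I means solving dx = z over a prescribed b, so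
deflations with G-acyclic kernel have this lifting property, and G-acyclic kernels and lifts of all
maps from G_s follow from it.

The small object argument for I gives both approximation sequences. Factoring 0 → B produces a cell
complex F → B; it is epi because the G_s separate, its kernel is G-acyclic, and F is filtered once
its cells are attached one at a time (`filtered_of_relativeCellComplex`). Factoring B → 0 embeds B
in a G-acyclic complex, degreewise split because cones of identities are G-acyclic.

An X in the left orthogonal splits its resolution F → X, so it is a summand of F. Conversely,
inflations with cokernel a disk or sphere are pushouts of 0 → D_n(G_s) or of maps in I
(`inflationsWithCokernelIn_le_llp_rlp`), hence lie in the class `rlp.llp`, which is stable under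
transfinite compositions and retracts; if 0 → X is in it, lifting the identity of X splits every
extension of X by a G-acyclic complex. -/

noncomputable section

namespace RelativeCotorsion

/-! ### Transfinite compositions from chains of subobjects. -/

section SubobjectChains

variable {A : Type u} [Category.{v} A] [Abelian A] {X : A}

/-- The functor to `A` attached to a monotone family of subobjects of `X`. -/
@[simps]
def subobjectFunctor {J : Type v} [Preorder J] (U : J → Subobject X) (hU : Monotone U) :
    J ⥤ MonoOver X where
  obj j := MonoOver.mk (U j).arrow
  map f := MonoOver.homMk (Subobject.ofLE _ _ (hU (leOfHom f)))

variable [IsGrothendieckAbelian.{v} A]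

/-- If the supremum of a chain of subobjects, indexed by a well-ordered type with a greatest
element, is `X`, if the chain is continuous, and if the inclusion of each term in the next one
belongs to `W`, then `0 ⟶ X` is a transfinite composition of morphisms in `W`. -/
lemma transfiniteCompositions_of_subobjects (W : MorphismProperty A)
    {J : Type v} [LinearOrder J] [OrderBot J] [SuccOrder J] [WellFoundedLT J] [OrderTop J]
    (U : J → Subobject X) (hU : Monotone U) (hbot : U ⊥ = ⊥) (htop : U ⊤ = ⊤)
    (hlim : ∀ m, Order.IsSuccLimit m → U m = ⨆ j : Set.Iio m, U j)
    (hsucc : ∀ j (_ : ¬ IsMax j), W (Subobject.ofLE _ _ (hU (Order.le_succ j)))) :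
    MorphismProperty.transfiniteCompositions.{v} W (0 : (0 : A) ⟶ X) := by
  have : IsIso (U ⊤).arrow := (Subobject.isIso_arrow_iff_eq_top _).2 htop
  let F : J ⥤ A := subobjectFunctor U hU ⋙ MonoOver.forget _ ⋙ Over.forget _
  have hF : F.IsWellOrderContinuous :=
    { nonempty_isColimit := fun m hm => ⟨by
        have := hm.nonempty_Iio.to_subtype
        let c := (Set.principalSegIio m).cocone (subobjectFunctor U hU ⋙ MonoOver.forget _)
        have : Mono c.pt.hom := inferInstanceAs (Mono (U m).arrow)
        -- Exactness of filtered colimits: the supremum of a chain of subobjects is its colimit.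
        apply IsGrothendieckAbelian.isColimitMapCoconeOfSubobjectMkEqISup
          ((Set.principalSegIio m).monotone.functor ⋙ subobjectFunctor U hU) c
        exact (Subobject.mk_arrow _).trans ((hlim m hm).trans
          (iSup_congr fun _ => (Subobject.mk_arrow _).symm))⟩ }
  rw [MorphismProperty.transfiniteCompositions_iff]
  refine ⟨J, inferInstance, inferInstance, inferInstance, inferInstance, ⟨?_⟩⟩
  have hz : IsZero (U ⊥ : A) := by
    rw [hbot]
    exact (isZero_zero A).of_iso Subobject.botCoeIsoZero
  exact
    { F := F
      isoBot := hz.iso (isZero_zero A)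
      isWellOrderContinuous := hF
      incl :=
        { app := fun j => (U j).arrow
          naturality := fun i j f =>
            (Subobject.ofLE_arrow (hU (leOfHom f))).trans (Category.comp_id _).symm }
      isColimit := by
        let e : F.obj ⊤ ≅ X := @asIso _ _ _ _ (U ⊤).arrow this
        exact IsColimit.ofIsoColimit (colimitOfDiagramTerminal isTerminalTop F)
          (Cocone.ext e fun j =>
            Subobject.ofLE_arrow (hU (leOfHom (isTerminalTop.from j))))
      fac := (isZero_zero A).eq_of_src _ _
      map_mem := fun j hj => hsucc j hj }

/-- Adjoining the pieces `c k` one by one gives the chain of suprema over i < j. The index j runs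
over `WithTop K`, so that the last term contains every piece. -/
lemma transfiniteCompositions_of_iSup (W : MorphismProperty A) {K : Type v} [LinearOrder K]
    [WellFoundedLT K] (c : K → Subobject X) (hc : ⨆ k, c k = ⊤)
    (hW : ∀ (k : K) (U V : Subobject X) (h : U ≤ V), U = ⨆ i : Set.Iio k, c i → V = U ⊔ c k →
      W (Subobject.ofLE U V h)) :
    MorphismProperty.transfiniteCompositions.{v} W (0 : (0 : A) ⟶ X) := by
  let _ : OrderBot (WithTop K) := WellFoundedLT.toOrderBot _
  let _ : SuccOrder (WithTop K) := SuccOrder.ofLinearWellFoundedLT _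
  let U (j : WithTop K) : Subobject X := ⨆ i : {i : K // (i : WithTop K) < j}, c i
  have le_U (j : WithTop K) (i : K) (hi : (i : WithTop K) < j) : c i ≤ U j :=
    le_iSup (fun i : {i : K // (i : WithTop K) < j} => c i) ⟨i, hi⟩
  have hU : Monotone U := fun j j' h => iSup_le fun i => le_U j' i (i.2.trans_le h)
  refine transfiniteCompositions_of_subobjects W U hU ?_ ?_ ?_ ?_
  · exact le_antisymm (iSup_le fun i => (not_lt_bot i.2).elim) bot_le
  · refine le_antisymm le_top ?_
    rw [← hc]
    exact iSup_le fun k => le_U _ k (WithTop.coe_lt_top k)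
  · intro m hm
    refine le_antisymm (iSup_le fun i => ?_) (iSup_le fun j => hU j.2.le)
    exact (le_U _ i.1 (Order.lt_succ_of_not_isMax (not_isMax_of_lt i.2))).trans
      (le_iSup (fun j : Set.Iio m => U j) ⟨_, hm.succ_lt i.2⟩)
  · intro j hj
    induction j using WithTop.recTopCoe with
    | top => exact (hj isMax_top).elim
    | coe k =>
      have h₁ : U k = ⨆ i : Set.Iio k, c i :=
        le_antisymm (iSup_le fun i => le_iSup (fun i : Set.Iio k => c i)
          ⟨i.1, WithTop.coe_lt_coe.1 i.2⟩) (iSup_le fun i => le_U _ _ (WithTop.coe_lt_coe.2 i.2))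
      have h₂ : U (Order.succ k) = (⨆ i : Set.Iio k, c i) ⊔ c k := by
        refine le_antisymm (iSup_le fun i => ?_) (sup_le ?_ ?_)
        · have h := WithTop.coe_le_coe.1 ((Order.lt_succ_iff_of_not_isMax hj).1 i.2)
          obtain h | h := h.lt_or_eq
          · exact (le_iSup (fun i : Set.Iio k => c i) ⟨i.1, h⟩).trans le_sup_left
          · rw [h]; exact le_sup_right
        · rw [← h₁]; exact hU (Order.le_succ _)
        · exact le_U _ _ (Order.lt_succ_of_not_isMax hj)
      exact hW k _ _ _ h₁ (h₂.trans (by rw [h₁]))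

end SubobjectChains

/-! ### Cell complexes are filtered by the cokernels of their cells. -/

section CellComplexes

variable {A : Type u} [Category.{v} A] [Abelian A]

/-- The kernel of a map on V that vanishes on U and on b is a subobject of X containing U and the
image of b, hence all of V. -/
lemma epi_desc_of_eq_sup {X B : A} {U V : Subobject X} (h : U ≤ V) (b : B ⟶ V)
    (hV : V ≤ U ⊔ imageSubobject (b ≫ V.arrow)) : Epi (biprod.desc (Subobject.ofLE U V h) b) := by
  refine Preadditive.epi_of_cancel_zero _ fun {T} f hf => ?_
  have h₁ : Subobject.ofLE U V h ≫ f = 0 := by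
    simpa using biprod.inl ≫= hf
  have h₂ : b ≫ f = 0 := by
    simpa using biprod.inr ≫= hf
  have hVN : V ≤ Subobject.mk (kernel.ι f ≫ V.arrow) := by
    refine hV.trans (sup_le ?_ ?_)
    · exact Subobject.le_mk_of_comm (kernel.lift f _ h₁) (by simp)
    · exact imageSubobject_le_mk _ _ (kernel.lift f b h₂) (by simp)
  have h₃ : Subobject.ofLEMk _ _ hVN ≫ kernel.ι f = 𝟙 _ := by
    rw [← cancel_mono V.arrow]
    simp
  rw [← Category.id_comp f, ← h₃, Category.assoc, kernel.condition, comp_zero]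

/-- Let `P ⟶ B ⟶ Z` be a short exact sequence and `b : B ⟶ X` a morphism such that the image of
`P` is contained in the subobject `U` of `X`. Then `(U ⊔ b(B)) / U` is `Z`, if the projection
`B ⟶ Z` extends to a morphism which vanishes on `U` and is defined on a subobject `M` of `X`. -/
lemma exists_shortExact_sup {X P B Z M : A} {U V : Subobject X} (h : U ≤ V) {i : P ⟶ B} {q : B ⟶ Z}
    {w : i ≫ q = 0} (hq : (ShortComplex.mk i q w).ShortExact) (m : M ⟶ X) [Mono m] (b : B ⟶ M)
    (hV : V = U ⊔ imageSubobject (b ≫ m)) (π : M ⟶ Z) (hb : b ≫ π = q) (u : (U : A) ⟶ M)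
    (hu : u ≫ m = U.arrow) (huπ : u ≫ π = 0) (hi : U.Factors (i ≫ b ≫ m)) :
    ∃ (p : (V : A) ⟶ Z) (w : Subobject.ofLE U V h ≫ p = 0) (b' : B ⟶ V),
      (ShortComplex.mk _ p w).ShortExact ∧ b' ≫ p = q := by
  have hVm : V ≤ Subobject.mk m := by
    rw [hV]
    exact sup_le (Subobject.le_mk_of_comm u hu) (imageSubobject_le_mk _ _ b rfl)
  have hbV : V.Factors (b ≫ m) := Subobject.factors_of_le _ (by rw [hV]; exact le_sup_right)
    ((Subobject.factors_iff _ _).2 ⟨factorThruImageSubobject (b ≫ m),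
      imageSubobject_arrow_comp (b ≫ m)⟩)
  have h₁ : Subobject.ofLEMk V m hVm ≫ m = V.arrow := by simp
  have h₂ : V.factorThru (b ≫ m) hbV ≫ Subobject.ofLEMk V m hVm = b := by
    rw [← cancel_mono m, Category.assoc, h₁, Subobject.factorThru_arrow]
  have h₃ : Subobject.ofLE U V h ≫ Subobject.ofLEMk V m hVm = u := by
    rw [← cancel_mono m, Category.assoc, h₁, Subobject.ofLE_arrow, hu]
  have h₄ : V.factorThru (b ≫ m) hbV ≫ Subobject.ofLEMk V m hVm ≫ π = q := by
    rw [reassoc_of% h₂, hb]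
  have h₅ : Subobject.ofLE U V h ≫ Subobject.ofLEMk V m hVm ≫ π = 0 := by
    rw [reassoc_of% h₃, huπ]
  refine ⟨_, h₅, _, ?_, h₄⟩
  have := hq.epi_g
  have : Epi (Subobject.ofLEMk V m hVm ≫ π) := by
    dsimp at this
    rw [← h₄] at this
    exact epi_of_epi (V.factorThru (b ≫ m) hbV) _
  refine ShortComplex.ShortExact.mk' ?_ inferInstance this
  rw [ShortComplex.exact_iff_exact_up_to_refinements]
  intro T x hx
  dsimp at x hx
  have := epi_desc_of_eq_sup h (V.factorThru (b ≫ m) hbV)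
    (by rw [Subobject.factorThru_arrow]; exact hV.le)
  -- Locally x is a sum of an element of U and the image of some element of B. If x dies in Z, that
  -- element of B comes from P, whose image lies in U.
  obtain ⟨T₁, ρ₁, _, y, hy⟩ := surjective_up_to_refinements_of_epi
    (biprod.desc (Subobject.ofLE U V h) (V.factorThru (b ≫ m) hbV)) x
  rw [biprod.desc_eq, Preadditive.comp_add] at hy
  have hyq : (y ≫ biprod.snd) ≫ q = 0 := by
    have := hy =≫ (Subobject.ofLEMk V m hVm ≫ π)
    rw [Category.assoc, hx, comp_zero, Preadditive.add_comp] at this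
    simpa [h₄, h₅] using this.symm
  obtain ⟨T₂, ρ₂, _, z, hz⟩ := hq.exact.exact_up_to_refinements _ hyq
  refine ⟨T₂, ρ₂ ≫ ρ₁, inferInstance, ρ₂ ≫ y ≫ biprod.fst + z ≫ U.factorThru _ hi, ?_⟩
  dsimp at hz ⊢
  rw [← cancel_mono V.arrow, Category.assoc ρ₂, hy]
  simp only [Preadditive.add_comp, Preadditive.comp_add, Category.assoc, Subobject.ofLE_arrow,
    Subobject.factorThru_arrow] at hz ⊢
  rw [reassoc_of% hz]

open HomotopicalAlgebra

variable {α : Type*} {P B : α → A} {g : ∀ a, P a ⟶ B a} {X Y : A} {f : X ⟶ Y}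

/-- A complex starting at 0 is generated by its cells, so stage j by the cells attached strictly
before j. With q the cokernel of a subobject, this bounds the image of stage j. -/
lemma comp_eq_zero_of_cells {J : Type v} [LinearOrder J] [OrderBot J] [SuccOrder J]
    [WellFoundedLT J] {f : (0 : A) ⟶ X} (c : RelativeCellComplex.{v} (fun _ : J => g) f) {T : A}
    (q : X ⟶ T) (j : J) (hq : ∀ γ : c.Cells, γ.j < j → γ.ι ≫ q = 0) : c.incl.app j ≫ q = 0 := by
  induction j using SuccOrder.limitRecOn with
  | isMin j hj =>
    obtain rfl := hj.eq_bot
    rw [← cancel_epi c.isoBot.inv]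
    exact (isZero_zero A).eq_of_src _ _
  | succ j hj hj' =>
    apply (c.attachCells j hj).hom_ext
    · have := hj' fun γ hγ => hq γ (hγ.trans_le (Order.le_succ j))
      rw [comp_zero, ← this]
      simp
    · intro i
      have := hq ⟨j, hj, i⟩ (Order.lt_succ_of_not_isMax hj)
      exact (Category.assoc _ _ _).symm.trans (this.trans comp_zero.symm)
  | isSuccLimit j hj hj' =>
    refine (c.F.isColimitOfIsWellOrderContinuous j hj).hom_ext fun ⟨k, hk⟩ => ?_
    have := hj' k hk fun γ hγ => hq γ (hγ.trans hk)
    have hn : c.F.map (homOfLE (show k ≤ j from le_of_lt hk)) ≫ c.incl.app j ≫ q = 0 := by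
      simpa using this
    exact hn.trans comp_zero.symm

/-- The projection on the cokernel of one cell. -/
lemma exists_cell_projection (c : AttachCells.{v} g f) (i : c.ι) {Z : A} (q : B (c.π i) ⟶ Z)
    (w : g (c.π i) ≫ q = 0) :
    ∃ π : Y ⟶ Z, f ≫ π = 0 ∧ c.cell i ≫ π = q ∧ ∀ i', i' ≠ i → c.cell i' ≫ π = 0 := by
  classical
  -- The map q on the chosen cell and zero on the others; it kills the boundaries, so it glues with
  -- zero on X.
  let φ (i' : c.ι) : B (c.π i') ⟶ Z :=
    if h : i' = i then eqToHom (by rw [h]) ≫ q else 0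
  have hφ (i' : c.ι) : g (c.π i') ≫ φ i' = 0 := by
    by_cases h : i' = i
    · subst h
      simp [φ, w]
    · simp [φ, h]
  have hm : c.g₁ ≫ (0 : X ⟶ Z) = c.m ≫ Cofan.IsColimit.desc c.isColimit₂ φ :=
    Cofan.IsColimit.hom_ext c.isColimit₁ _ _ fun i' => by
      rw [AttachCells.hm_assoc, Cofan.IsColimit.fac, hφ, comp_zero, comp_zero]
  refine ⟨c.isPushout.desc _ _ hm, c.isPushout.inl_desc _ _ _, ?_, fun i' hi' => ?_⟩
  · rw [AttachCells.cell_def, Category.assoc, c.isPushout.inr_desc, Cofan.IsColimit.fac]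
    simp [φ]
  · rw [AttachCells.cell_def, Category.assoc, c.isPushout.inr_desc, Cofan.IsColimit.fac]
    simp [φ, hi']

lemma factors_of_comp_cokernel_π (U : Subobject X) {T : A} (t : T ⟶ X)
    (ht : t ≫ cokernel.π U.arrow = 0) : U.Factors t :=
  (Subobject.factors_iff _ _).2
    ⟨(Abelian.monoIsKernelOfCokernel _ (cokernelIsCokernel U.arrow)).lift (KernelFork.ofι t ht),
      Fork.IsLimit.lift_ι (Abelian.monoIsKernelOfCokernel _ (cokernelIsCokernel U.arrow))⟩

/-- Order lexicographically by ρ, breaking ties with an arbitrary well-order. This puts cells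
attached simultaneously in succession while respecting the stages. -/
lemma exists_linearOrder_monotone {K J : Type*} [LinearOrder J] [WellFoundedLT J] (ρ : K → J) :
    ∃ (_ : LinearOrder K) (_ : WellFoundedLT K), Monotone ρ := by
  obtain ⟨o, ho⟩ := exists_wellFoundedLT K
  let e (k : K) : J ×ₗ K := toLex (ρ k, k)
  have he : Function.Injective e := fun k k' h => (Prod.ext_iff.1 (toLex.injective h)).2
  refine ⟨LinearOrder.lift' e he, ⟨InvImage.wf e wellFounded_lt⟩, fun k k' h => ?_⟩
  exact Prod.Lex.monotone_fst (e k) (e k') h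

variable [IsGrothendieckAbelian.{v} A]

/-- If the inflations `g a : P a ⟶ B a` have their cokernels in `S`, then a cell complex obtained
by attaching these cells is `S`-filtered. -/
theorem filtered_of_relativeCellComplex (E : ObjectProperty (ShortComplex A)) (S : ObjectProperty A)
    (hE : ∀ T : ShortComplex A, T.ShortExact → ∀ {P Q : A} (k : P ⟶ Q) (b : Q ⟶ T.X₂)
      (w : k ≫ b ≫ T.g = 0), E (ShortComplex.mk k (b ≫ T.g) w) → E T)
    {Z : α → A} (q : ∀ a, B a ⟶ Z a) (w : ∀ a, g a ≫ q a = 0)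
    (hq : ∀ a, (ShortComplex.mk _ _ (w a)).ShortExact) (hqE : ∀ a, E (ShortComplex.mk _ _ (w a)))
    (hS : ∀ a, S (Z a)) {J : Type v} [LinearOrder J] [OrderBot J] [SuccOrder J] [WellFoundedLT J]
    {f : (0 : A) ⟶ X} (c : RelativeCellComplex.{v} (fun _ : J => g) f)
    (hc : ∀ j, Mono (c.incl.app j)) :
    filtered E S X := by
  obtain ⟨_, _, hρ⟩ := exists_linearOrder_monotone (fun γ : c.Cells => γ.j)
  have hcell (γ : c.Cells) {T : Subobject X} (hT : imageSubobject γ.ι ≤ T) :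
      γ.ι ≫ cokernel.π T.arrow = 0 := by
    rw [← imageSubobject_arrow_comp γ.ι, ← Subobject.ofLE_arrow hT, Category.assoc,
      Category.assoc, cokernel.condition, comp_zero, comp_zero]
  refine transfiniteCompositions_of_iSup _ (fun γ : c.Cells => imageSubobject γ.ι) ?_ ?_
  · have h : cokernel.π (⨆ γ : c.Cells, imageSubobject γ.ι).arrow = 0 :=
      c.hom_ext ((isZero_zero A).eq_of_src _ _) fun γ => by
        rw [hcell γ (le_iSup (fun γ : c.Cells => imageSubobject γ.ι) γ), comp_zero]
    have := Preadditive.epi_of_cokernel_zero h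
    exact (Subobject.isIso_arrow_iff_eq_top _).1 (isIso_of_mono_of_epi _)
  · intro γ U V h hU hV
    let a := c.attachCells γ.j γ.hj
    let inc (j : J) : c.F.obj j ⟶ X := c.incl.app j
    have hinc {i j : J} (hij : i ≤ j) : c.F.map (homOfLE hij) ≫ inc j = inc i :=
      (c.incl.naturality (homOfLE hij)).trans (Category.comp_id _)
    have : Mono (inc (Order.succ γ.j)) := hc _
    obtain ⟨π, hπ₁, hπ₂, hπ₃⟩ := exists_cell_projection a γ.k (q _) (w _)
    -- The cells before γ are killed by π: those of earlier stages factor through stage `γ.j`, where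
    -- π is zero, and those of the same stage are different cells.
    have hUN : U ≤ Subobject.mk (kernel.ι π ≫ inc (Order.succ γ.j)) := by
      have key (γ' : c.Cells) (hγ' : γ' < γ) :
          ∃ x : B ((c.attachCells γ'.j γ'.hj).π γ'.k) ⟶ _, x ≫ inc (Order.succ γ.j) = γ'.ι ∧ x ≫ π = 0 := by
        have hle : γ'.j ≤ γ.j := hρ hγ'.le
        obtain hlt | heq := hle.lt_or_eq
        · refine ⟨(c.attachCells γ'.j γ'.hj).cell γ'.k ≫
            c.F.map (homOfLE (Order.succ_le_of_lt hlt)) ≫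
            c.F.map (homOfLE (Order.le_succ γ.j)), ?_, ?_⟩
          · rw [Category.assoc, Category.assoc, hinc, hinc]
            rfl
          · rw [Category.assoc, Category.assoc, hπ₁, comp_zero, comp_zero]
        · obtain ⟨j, hj, k⟩ := γ
          obtain ⟨j', hj', k'⟩ := γ'
          obtain rfl : j' = j := heq
          exact ⟨a.cell k', rfl, hπ₃ k' fun hk => hγ'.ne (by rw [hk])⟩
      rw [hU]
      refine iSup_le fun ⟨γ', hγ'⟩ => ?_
      obtain ⟨x, hx, hx'⟩ := key γ' hγ'
      exact imageSubobject_le_mk _ _ (kernel.lift π x hx')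
        ((kernel.lift_ι_assoc π x hx' _).trans hx)
    -- All cells of earlier stages precede γ, so U contains the image of stage `γ.j`, and with it
    -- the boundary of γ.
    have hUF : U.Factors (inc γ.j) := factors_of_comp_cokernel_π U _
      (comp_eq_zero_of_cells c _ _ fun γ' hγ' => hcell γ' (by
        rw [hU]
        exact le_iSup (fun γ' : Set.Iio γ => imageSubobject γ'.1.ι)
          ⟨γ', lt_of_not_ge fun hle => (hρ hle).not_gt hγ'⟩))
    have hgF : U.Factors (g (a.π γ.k) ≫ a.cell γ.k ≫ inc (Order.succ γ.j)) := by
      have : g (a.π γ.k) ≫ a.cell γ.k ≫ inc (Order.succ γ.j) =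
          (a.cofan₁.inj γ.k ≫ a.g₁) ≫ inc γ.j := by
        rw [AttachCells.cell_def, Category.assoc, ← hinc (Order.le_succ γ.j), Category.assoc,
          a.isPushout.w_assoc, a.hm_assoc]
      rw [this]
      exact Subobject.factors_of_factors_right _ hUF
    obtain ⟨p, w', b', hp, hb'⟩ := exists_shortExact_sup h (hq (a.π γ.k)) (inc (Order.succ γ.j))
      (a.cell γ.k) hV π hπ₂ (Subobject.ofLEMk _ _ hUN ≫ kernel.ι π)
      (by rw [Category.assoc, Subobject.ofLEMk_comp])
      (by rw [Category.assoc, kernel.condition, comp_zero]) hgF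
    refine ⟨_, p, w', hS _, hE _ hp (g (a.π γ.k)) b' ?_ ?_⟩
    · dsimp
      rw [hb', w]
    · have key : ∀ (q' : B (a.π γ.k) ⟶ Z (a.π γ.k)) (w'' : g (a.π γ.k) ≫ q' = 0),
          q' = q (a.π γ.k) →
          E (ShortComplex.mk _ _ w'') := by
        rintro _ _ rfl
        exact hqE _
      exact key _ _ hb'

end CellComplexes

/-! ### Pushouts of short exact sequences and splitting of extensions. -/

section Extensions

variable {A : Type u} [Category.{v} A] [Abelian A]

lemma exists_shortExact_of_isPushout {P Q Z U V : A} {i : P ⟶ Q} {q : Q ⟶ Z} {w : i ≫ q = 0}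
    (hq : (ShortComplex.mk i q w).ShortExact) {h : P ⟶ U} {j : U ⟶ V} {k : Q ⟶ V}
    (sq : IsPushout h i j k) :
    ∃ (p : V ⟶ Z) (w : j ≫ p = 0), k ≫ p = q ∧ (ShortComplex.mk j p w).ShortExact := by
  have hmono : Mono i := hq.mono_f
  have hepi : Epi q := hq.epi_g
  have h₁ : h ≫ (0 : U ⟶ Z) = i ≫ q := by rw [w, comp_zero]
  have h₂ : k ≫ sq.desc 0 q h₁ = q := sq.inr_desc _ _ _
  have h₃ : j ≫ sq.desc 0 q h₁ = 0 := sq.inl_desc _ _ _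
  have : Mono j := (MorphismProperty.monomorphisms A).of_isPushout sq hmono
  have : Epi (sq.desc 0 q h₁) := epi_of_epi_fac h₂
  refine ⟨_, h₃, h₂, ShortComplex.ShortExact.mk' ?_ ‹_› ‹_›⟩
  rw [ShortComplex.exact_iff_exact_up_to_refinements]
  intro T x hx
  dsimp at x hx
  obtain ⟨T₁, ρ, _, a, b, hab⟩ := sq.hom_eq_add_up_to_refinements x
  have hb : b ≫ q = 0 := by
    have := hab =≫ sq.desc 0 q h₁
    rw [Category.assoc, hx, comp_zero, Preadditive.add_comp] at this
    simpa [h₂, h₃] using this.symm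
  obtain ⟨T₂, ρ₂, _, c, hc⟩ := hq.exact.exact_up_to_refinements _ hb
  refine ⟨T₂, ρ₂ ≫ ρ, inferInstance, ρ₂ ≫ a + c ≫ h, ?_⟩
  dsimp at hc ⊢
  rw [Category.assoc, hab, Preadditive.comp_add, Preadditive.add_comp, reassoc_of% hc,
    Category.assoc, Category.assoc, sq.w]

/-- The true pushout is an extension with the same ends as `T₂`, up to `φ.τ₃`, so the five lemma
identifies the two. -/
lemma isPushout_of_shortExact {T₁ T₂ : ShortComplex A} (φ : T₁ ⟶ T₂) (h₁ : T₁.ShortExact)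
    (h₂ : T₂.ShortExact) [IsIso φ.τ₃] : IsPushout φ.τ₁ T₁.f T₂.f φ.τ₂ := by
  have sq := IsPushout.of_hasPushout φ.τ₁ T₁.f
  obtain ⟨p, w, hp, hs⟩ := exists_shortExact_of_isPushout h₁ sq
  have := h₁.epi_g
  let t := sq.desc T₂.f φ.τ₂ φ.comm₁₂
  have ht : t ≫ T₂.g = p ≫ φ.τ₃ := by
    refine sq.hom_ext ?_ ?_
    · rw [sq.inl_desc_assoc, T₂.zero, reassoc_of% w, zero_comp]
    · rw [sq.inr_desc_assoc, reassoc_of% hp, φ.comm₂₃]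
  let ψ : ShortComplex.mk _ _ w ⟶ T₂ :=
    { τ₁ := 𝟙 _, τ₂ := t, τ₃ := φ.τ₃, comm₁₂ := by simp [t], comm₂₃ := ht }
  have : IsIso ψ.τ₁ := inferInstanceAs (IsIso (𝟙 _))
  have : IsIso ψ.τ₃ := ‹IsIso φ.τ₃›
  have : IsIso t := ShortComplex.isIso₂_of_shortExact_of_isIso₁₃ ψ hs h₂
  exact sq.of_iso (Iso.refl _) (Iso.refl _) (Iso.refl _) (asIso t) (by simp) (by simp)
    (by simp [t]) (by simp [t])

lemma shortExact_zero_id (X : A) :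
    (ShortComplex.mk (0 : (0 : A) ⟶ X) (𝟙 X) zero_comp).ShortExact where
  exact := (ShortComplex.exact_iff_mono _ rfl).2 (inferInstanceAs (Mono (𝟙 X)))
  mono_f := (isZero_zero _).mono _
  epi_g := inferInstanceAs (Epi (𝟙 X))

variable {E : ObjectProperty (ShortComplex A)}

lemma subsingleton_yonedaExt (hE : ∀ T, E T → T.ShortExact) {X Y : A}
    (h : ∀ e : YonedaExtension E X Y, ∃ s : X ⟶ e.M, s ≫ e.p = 𝟙 X) :
    Subsingleton (YonedaExt E X Y) := by
  refine ⟨fun a b => ?_⟩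
  induction a using Quotient.inductionOn with | _ e₁
  induction b using Quotient.inductionOn with | _ e₂
  obtain ⟨s₁, hs₁⟩ := h e₁
  obtain ⟨s₂, hs₂⟩ := h e₂
  have := (hE _ e₁.exact).mono_f
  let S := ShortComplex.Splitting.ofExactOfSection _ (hE _ e₁.exact).exact s₁ hs₁ this
  -- Both extensions are split; t matches their summands.
  let t : e₁.M ⟶ e₂.M := S.r ≫ e₂.i + e₁.p ≫ s₂
  have h₁ : e₁.i ≫ t = e₂.i := by
    have h₁ : e₁.i ≫ S.r = 𝟙 _ := S.f_r
    simp [t, reassoc_of% h₁, reassoc_of% e₁.zero]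
  have h₂ : t ≫ e₂.p = e₁.p := by simp [t, hs₂, e₂.zero]
  let ψ : ShortComplex.mk _ _ e₁.zero ⟶ ShortComplex.mk _ _ e₂.zero :=
    { τ₁ := 𝟙 _, τ₂ := t, τ₃ := 𝟙 _, comm₁₂ := by simp [h₁], comm₂₃ := by simp [h₂] }
  have : IsIso ψ.τ₁ := inferInstanceAs (IsIso (𝟙 _))
  have : IsIso ψ.τ₃ := inferInstanceAs (IsIso (𝟙 _))
  have : IsIso t := ShortComplex.isIso₂_of_shortExact_of_isIso₁₃ ψ (hE _ e₁.exact) (hE _ e₂.exact)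
  exact Quotient.sound ⟨asIso t, h₁, h₂⟩

lemma exists_section_of_subsingleton
    (hE : ∀ X Y : A, E (ShortComplex.mk (biprod.inl : Y ⟶ Y ⊞ X) biprod.snd biprod.inl_snd))
    {X Y : A} [Subsingleton (YonedaExt E X Y)] (e : YonedaExtension E X Y) :
    ∃ s : X ⟶ e.M, s ≫ e.p = 𝟙 X := by
  have h := Subsingleton.elim (α := YonedaExt E X Y)
    (Quotient.mk (YonedaExtension.setoid E X Y) ⟨_, _, _, _, hE X Y⟩)
    (Quotient.mk (YonedaExtension.setoid E X Y) e)
  obtain ⟨φ, -, hφ⟩ := Quotient.exact h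
  exact ⟨biprod.inr ≫ φ.hom, by rw [Category.assoc, hφ, biprod.inr_snd]⟩

end Extensions

/-! ### Spheres, disks and lifting against S_{n+1}(M) → D_n(M). -/

section Cells

open HomologicalComplex

variable {C : Type u} [Category.{v} C] [Abelian C] {M : C} {K : CochainComplex C ℤ} {n : ℤ}

lemma int_ne_add_one (n : ℤ) : n ≠ n + 1 := by omega

/-- The morphism `S_n(M) ⟶ K` attached to a cycle. -/
def sphereDesc (z : M ⟶ K.X n) (hz : z ≫ K.d n (n + 1) = 0) : sphere n M ⟶ K :=
  mkHomFromSingle z (by rintro _ rfl; exact hz)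

/-- The element of degree `n` of `S_n(M)`. -/
def sphereι (n : ℤ) (M : C) : M ⟶ (sphere n M).X n := (singleObjXSelf _ n M).inv

instance : IsIso (sphereι n M) := inferInstanceAs (IsIso (singleObjXSelf _ n M).inv)

@[simp]
lemma sphereι_desc (z : M ⟶ K.X n) (hz : z ≫ K.d n (n + 1) = 0) :
    sphereι n M ≫ (sphereDesc z hz).f n = z := by
  exact (congrArg (sphereι n M ≫ ·) (mkHomFromSingle_f z _)).trans
    (Iso.inv_hom_id_assoc (singleObjXSelf (ComplexShape.up ℤ) n M) z)

@[simp]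
lemma sphereι_desc_assoc (z : M ⟶ K.X n) (hz : z ≫ K.d n (n + 1) = 0) {N : C} (f : K.X n ⟶ N) :
    sphereι n M ≫ (sphereDesc z hz).f n ≫ f = z ≫ f := by
  rw [← Category.assoc, sphereι_desc]

lemma sphere_hom_ext {f g : sphere n M ⟶ K} (h : sphereι n M ≫ f.f n = sphereι n M ≫ g.f n) :
    f = g := by
  have h' : f.f n = g.f n := (cancel_epi (sphereι n M)).1 h
  exact from_single_hom_ext h'

lemma isZero_sphere_X (k : ℤ) (hk : k ≠ n) : IsZero ((sphere n M).X k) :=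
  isZero_single_obj_X _ _ _ _ hk

@[simp]
lemma sphere_d (k l : ℤ) : (sphere n M).d k l = 0 := single_obj_d _ _ _ _ _

/-- The morphism `D_n(M) ⟶ K` attached to an element of degree `n`. -/
def diskDesc (x : M ⟶ K.X n) : disk n M ⟶ K :=
  mkHomFromDouble _ (int_ne_add_one n) x (x ≫ K.d n (n + 1)) (by simp) (by simp)

/-- The element of degree `n` of `D_n(M)`. -/
def diskι (n : ℤ) (M : C) : M ⟶ (disk n M).X n := (doubleXIso₀ _ _).inv

instance : IsIso (diskι n M) := inferInstanceAs (IsIso (doubleXIso₀ _ _).inv)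

lemma diskι_d : diskι n M ≫ (disk n M).d n (n + 1) =
    (doubleXIso₁ (𝟙 M) (show (ComplexShape.up ℤ).Rel n (n + 1) from rfl) (int_ne_add_one n)).inv := by
  simp [diskι, disk, double_d _ _ (int_ne_add_one n)]

instance : IsIso (diskι n M ≫ (disk n M).d n (n + 1)) := by
  rw [diskι_d]
  exact Iso.isIso_inv _

@[simp]
lemma diskι_desc (x : M ⟶ K.X n) : diskι n M ≫ (diskDesc x).f n = x := by
  exact (congrArg (diskι n M ≫ ·) (mkHomFromDouble_f₀ _ _ x _ _ _)).trans
    (Iso.inv_hom_id_assoc (doubleXIso₀ (𝟙 M) (show (ComplexShape.up ℤ).Rel n (n + 1) from rfl)) x)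

@[simp]
lemma diskι_desc_assoc (x : M ⟶ K.X n) {N : C} (f : K.X n ⟶ N) :
    diskι n M ≫ (diskDesc x).f n ≫ f = x ≫ f := by
  rw [← Category.assoc, diskι_desc]

lemma disk_hom_ext {f g : disk n M ⟶ K} (h : diskι n M ≫ f.f n = diskι n M ≫ g.f n) : f = g := by
  have h₁ : f.f n = g.f n := (cancel_epi (diskι n M)).1 h
  have h₂ : f.f (n + 1) = g.f (n + 1) := by
    rw [← cancel_epi (diskι n M ≫ (disk n M).d n (n + 1)), Category.assoc, Category.assoc,
      ← Hom.comm, ← Hom.comm, h₁]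
  exact from_double_hom_ext h₁ h₂

lemma isZero_disk_X (k : ℤ) (hk : k ≠ n) (hk' : k ≠ n + 1) : IsZero ((disk n M).X k) :=
  isZero_double_X _ _ _ hk hk'

/-- The inclusion `S_{n+1}(M) ⟶ D_n(M)`. -/
def sphereToDisk (n : ℤ) (M : C) : sphere (n + 1) M ⟶ disk n M :=
  sphereDesc (diskι n M ≫ (disk n M).d n (n + 1)) (by simp)

/-- The projection `D_n(M) ⟶ S_n(M)`. -/
def diskToSphere (n : ℤ) (M : C) : disk n M ⟶ sphere n M := diskDesc (sphereι n M)

@[simp]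
lemma sphereι_sphereToDisk :
    sphereι (n + 1) M ≫ (sphereToDisk n M).f (n + 1) = diskι n M ≫ (disk n M).d n (n + 1) := by
  simp [sphereToDisk]

@[simp]
lemma sphereι_sphereToDisk_assoc {N : C} (f : (disk n M).X (n + 1) ⟶ N) :
    sphereι (n + 1) M ≫ (sphereToDisk n M).f (n + 1) ≫ f =
      diskι n M ≫ (disk n M).d n (n + 1) ≫ f := by
  rw [← Category.assoc, sphereι_sphereToDisk, Category.assoc]

@[simp]
lemma diskι_diskToSphere : diskι n M ≫ (diskToSphere n M).f n = sphereι n M := by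
  simp [diskToSphere]

@[simp]
lemma sphereToDisk_diskToSphere : sphereToDisk n M ≫ diskToSphere n M = 0 :=
  sphere_hom_ext (by simp [← Hom.comm])

instance : IsIso ((diskToSphere n M).f n) := by
  have : IsIso (diskι n M ≫ (diskToSphere n M).f n) := by
    rw [diskι_diskToSphere]
    infer_instance
  exact IsIso.of_isIso_comp_left (diskι n M) _

lemma isIso_sphereToDisk_f (k : ℤ) (hk : k ≠ n) : IsIso ((sphereToDisk n M).f k) := by
  by_cases h : k = n + 1
  · subst h
    have : IsIso (sphereι (n + 1) M ≫ (sphereToDisk n M).f (n + 1)) := by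
      rw [sphereι_sphereToDisk]
      infer_instance
    exact IsIso.of_isIso_comp_left (sphereι (n + 1) M) _
  · exact (isZero_sphere_X k h).isIso (isZero_disk_X k hk h) _

lemma shortExact_sphereToDisk (n : ℤ) (M : C) :
    (ShortComplex.mk _ _ (sphereToDisk_diskToSphere (n := n) (M := M))).ShortExact := by
  refine shortExact_of_degreewise_shortExact _ fun k => ?_
  by_cases hk : k = n
  · subst hk
    have h₁ : (sphereToDisk k M).f k = 0 := (isZero_sphere_X k (int_ne_add_one k)).eq_of_src _ _
    exact
      { exact := (ShortComplex.exact_iff_mono _ h₁).2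
          (inferInstanceAs (Mono ((diskToSphere k M).f k)))
        mono_f := (isZero_sphere_X k (int_ne_add_one k)).mono ((sphereToDisk k M).f k)
        epi_g := inferInstanceAs (Epi ((diskToSphere k M).f k)) }
  · have h₁ : (diskToSphere n M).f k = 0 := (isZero_sphere_X k hk).eq_of_tgt _ _
    have := isIso_sphereToDisk_f (M := M) k hk
    exact
      { exact := (ShortComplex.exact_iff_epi _ h₁).2
          (inferInstanceAs (Epi ((sphereToDisk n M).f k)))
        mono_f := inferInstanceAs (Mono ((sphereToDisk n M).f k))
        epi_g := (isZero_sphere_X k hk).epi ((diskToSphere n M).f k) }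

lemma exists_section_diskToSphere_f (n : ℤ) (M : C) (k : ℤ) :
    ∃ s, s ≫ (diskToSphere n M).f k = 𝟙 _ := by
  by_cases hk : k = n
  · subst hk
    exact ⟨inv ((diskToSphere k M).f k), by simp⟩
  · exact ⟨0, (isZero_sphere_X k hk).eq_of_src _ _⟩

/-- Maps out of a sphere are cycles and maps out of a disk are arbitrary elements, so a square is a
pair (z, b) and a filler is an x. -/
lemma hasLiftingProperty_sphereToDisk_iff {X Y : CochainComplex C ℤ} (p : X ⟶ Y) :
    HasLiftingProperty (sphereToDisk n M) p ↔
      ∀ (z : M ⟶ X.X (n + 1)) (b : M ⟶ Y.X n), z ≫ X.d (n + 1) (n + 1 + 1) = 0 →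
        b ≫ Y.d n (n + 1) = z ≫ p.f (n + 1) →
        ∃ x : M ⟶ X.X n, x ≫ X.d n (n + 1) = z ∧ x ≫ p.f n = b := by
  constructor
  · intro _ z b hz hb
    have sq : CommSq (sphereDesc z hz) (sphereToDisk n M) p (diskDesc b) := ⟨sphere_hom_ext (by
      simp [← Hom.comm, hb])⟩
    refine ⟨diskι n M ≫ sq.lift.f n, ?_, ?_⟩
    · rw [Category.assoc, Hom.comm, ← sphereι_sphereToDisk_assoc, ← comp_f, sq.fac_left,
        sphereι_desc]
    · rw [Category.assoc, ← comp_f, sq.fac_right, diskι_desc]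
  · intro h
    refine ⟨fun {u v} sq => ?_⟩
    obtain ⟨x, hx₁, hx₂⟩ := h (sphereι _ _ ≫ u.f (n + 1)) (diskι _ _ ≫ v.f n) (by simp) (by
      rw [Category.assoc, Category.assoc, ← comp_f, sq.w, comp_f, sphereι_sphereToDisk_assoc,
        Hom.comm])
    refine ⟨⟨diskDesc x, sphere_hom_ext ?_, disk_hom_ext ?_⟩⟩
    · simp [← Hom.comm, hx₁]
    · simp [hx₂]

end Cells

/-! ### G-exactness, G-acyclic complexes and the orthogonal of the disks and spheres. -/

section GExact

open HomologicalComplex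

variable {C : Type u} [Category.{v} C] [Abelian C] {ι : Type v} (G : ι → C)

/-- The complexes `Y` such that `Hom(G_s, Y)` is acyclic for all `s`. -/
def IsGAcyclic (Y : CochainComplex C ℤ) : Prop :=
  ∀ (n : ℤ) (s : ι) (z : G s ⟶ Y.X (n + 1)), z ≫ Y.d (n + 1) (n + 1 + 1) = 0 →
    ∃ x : G s ⟶ Y.X n, x ≫ Y.d n (n + 1) = z

/-- The morphisms of complexes `p` such that every `G_s ⟶ Y^n` lifts along `p^n`. -/
def IsGEpi {X Y : CochainComplex C ℤ} (p : X ⟶ Y) : Prop :=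
  ∀ (n : ℤ) (s : ι) (y : G s ⟶ Y.X n), ∃ x : G s ⟶ X.X n, x ≫ p.f n = y

/-- The inclusions of the spheres on the objects `G_s` in the corresponding disks. -/
def spheresToDisks : MorphismProperty (CochainComplex C ℤ) :=
  MorphismProperty.ofHoms fun a : ℤ × ι => sphereToDisk a.1 (G a.2)

variable {G}

lemma gExact_iff [HasCoproduct G] (T : ShortComplex C) :
    gExact (∐ G) T ↔ T.ShortExact ∧
      ∀ (s : ι) (x : G s ⟶ T.X₃), ∃ y : G s ⟶ T.X₂, y ≫ T.g = x := by
  have hsurj : Function.Surjective (fun y : ∐ G ⟶ T.X₂ => y ≫ T.g) ↔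
      ∀ (s : ι) (x : G s ⟶ T.X₃), ∃ y : G s ⟶ T.X₂, y ≫ T.g = x := by
    constructor
    · intro h s x
      classical
      -- Extend x by zero to the other summands.
      obtain ⟨y, hy⟩ := h (Sigma.π G s ≫ x)
      dsimp only at hy
      exact ⟨Sigma.ι G s ≫ y, by rw [Category.assoc, hy, Sigma.ι_π_eq_id_assoc]⟩
    · intro h x
      choose y hy using fun s => h s (Sigma.ι G s ≫ x)
      exact ⟨Sigma.desc y, Sigma.hom_ext _ _ fun s => by simp [hy]⟩
  rw [← hsurj]
  refine and_congr_right fun hT => ⟨fun h => ?_, fun h => ?_⟩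
  · exact (AddCommGrpCat.epi_iff_surjective _).1 h.epi_g
  · have := hT.mono_f
    exact ShortComplex.ShortExact.mk' (hT.exact.map_of_mono_of_preservesKernel _ this inferInstance)
      (inferInstanceAs (Mono ((preadditiveCoyoneda.obj (op (∐ G))).map T.f)))
      ((AddCommGrpCat.epi_iff_surjective _).2 h)

lemma degreewiseGExact_iff [HasCoproduct G] (T : ShortComplex (CochainComplex C ℤ)) :
    degreewiseGExact (∐ G) T ↔ T.ShortExact ∧ IsGEpi G T.g := by
  refine and_congr_right fun hT => forall_congr' fun n => ?_
  rw [gExact_iff]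
  exact and_iff_right (hT.map_of_exact _)

lemma degreewiseGExact_of_comp [HasCoproduct G] (T : ShortComplex (CochainComplex C ℤ))
    (hT : T.ShortExact) {P Q : CochainComplex C ℤ} (k : P ⟶ Q) (b : Q ⟶ T.X₂)
    (w : k ≫ b ≫ T.g = 0) (h : degreewiseGExact (∐ G) (ShortComplex.mk k (b ≫ T.g) w)) :
    degreewiseGExact (∐ G) T := by
  rw [degreewiseGExact_iff] at h ⊢
  refine ⟨hT, fun n s y => ?_⟩
  obtain ⟨x, hx⟩ := h.2 n s y
  exact ⟨x ≫ b.f n, by simpa using hx⟩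

lemma degreewiseGExact_of_shortExact_of_retraction [HasCoproduct G]
    {T : ShortComplex (CochainComplex C ℤ)} (hT : T.ShortExact)
    (h : ∀ n, ∃ r, T.f.f n ≫ r = 𝟙 (T.X₁.X n)) : degreewiseGExact (∐ G) T := by
  refine (degreewiseGExact_iff T).2 ⟨hT, fun n s y => ?_⟩
  obtain ⟨r, hr⟩ := h n
  have hn : (T.map (eval C (ComplexShape.up ℤ) n)).ShortExact := hT.map_of_exact _
  let S := ShortComplex.Splitting.ofExactOfRetraction _ hn.exact r hr hn.epi_g
  exact ⟨y ≫ S.s, (Category.assoc _ _ _).trans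
    ((congrArg (y ≫ ·) S.s_g).trans (Category.comp_id y))⟩

lemma degreewiseGExact_biprod [HasCoproduct G] (X Y : CochainComplex C ℤ) :
    degreewiseGExact (∐ G)
      (ShortComplex.mk (biprod.inl : Y ⟶ Y ⊞ X) biprod.snd biprod.inl_snd) :=
  degreewiseGExact_of_shortExact_of_retraction
    (ShortComplex.Splitting.ofHasBinaryBiproduct Y X).shortExact
    fun n => ⟨(biprod.fst : Y ⊞ X ⟶ Y).f n, by
      dsimp
      rw [← comp_f, biprod.inl_fst, id_f]⟩

lemma degreewiseGExact_sphereToDisk [HasCoproduct G] (n : ℤ) (M : C) :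
    degreewiseGExact (∐ G) (ShortComplex.mk _ _ (sphereToDisk_diskToSphere (n := n) (M := M))) := by
  refine (degreewiseGExact_iff _).2 ⟨shortExact_sphereToDisk n M, fun k s y => ?_⟩
  obtain ⟨t, ht⟩ := exists_section_diskToSphere_f n M k
  exact ⟨y ≫ t, by dsimp; rw [Category.assoc, ht, Category.comp_id]⟩

lemma rlp_spheresToDisks_iff {X Y : CochainComplex C ℤ} (p : X ⟶ Y) :
    (spheresToDisks G).rlp p ↔
      ∀ (n : ℤ) (s : ι) (z : G s ⟶ X.X (n + 1)) (b : G s ⟶ Y.X n),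
        z ≫ X.d (n + 1) (n + 1 + 1) = 0 → b ≫ Y.d n (n + 1) = z ≫ p.f (n + 1) →
        ∃ x : G s ⟶ X.X n, x ≫ X.d n (n + 1) = z ∧ x ≫ p.f n = b := by
  constructor
  · intro h n s
    exact (hasLiftingProperty_sphereToDisk_iff p).1 (h _ ⟨(n, s)⟩)
  · rintro h _ _ _ ⟨n, s⟩
    exact (hasLiftingProperty_sphereToDisk_iff p).2 (h n s)

lemma rlp_zero_iff (Y : CochainComplex C ℤ) :
    (spheresToDisks G).rlp (0 : Y ⟶ 0) ↔ IsGAcyclic G Y := by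
  rw [rlp_spheresToDisks_iff]
  have hz (n : ℤ) : IsZero ((0 : CochainComplex C ℤ).X n) :=
    (eval C (ComplexShape.up ℤ) n).map_isZero (isZero_zero _)
  constructor
  · intro h n s z hz'
    obtain ⟨x, hx, -⟩ := h n s z 0 hz' ((hz _).eq_of_tgt _ _)
    exact ⟨x, hx⟩
  · intro h n s z b hz' _
    obtain ⟨x, hx⟩ := h n s z hz'
    exact ⟨x, hx, (hz _).eq_of_tgt _ _⟩

/-- Two lifts are needed: first dy is lifted to a cycle z of X, then y to an x with dx = z. -/
lemma isGEpi_of_rlp {X Y : CochainComplex C ℤ} {p : X ⟶ Y} (hp : (spheresToDisks G).rlp p) :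
    IsGEpi G p := by
  rw [rlp_spheresToDisks_iff] at hp
  intro n s y
  obtain ⟨z, hz, hz'⟩ := hp (n + 1) s 0 (y ≫ Y.d n (n + 1)) (by simp) (by simp)
  obtain ⟨x, -, hx⟩ := hp n s z y hz hz'.symm
  exact ⟨x, hx⟩

lemma epi_of_isGEpi (hG : (ObjectProperty.ofObj G).IsSeparating) {X Y : CochainComplex C ℤ}
    {p : X ⟶ Y} (hp : IsGEpi G p) : Epi p := by
  refine epi_of_epi_f _ fun n => Preadditive.epi_of_cancel_zero _ fun f hf => ?_
  rw [Preadditive.isSeparating_iff] at hG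
  refine hG f ?_
  rintro _ ⟨s⟩ y
  obtain ⟨x, rfl⟩ := hp n s y
  rw [Category.assoc, hf, comp_zero]

/-- The lifting property with respect to the inclusions of spheres in disks of a deflation with
acyclic kernel. -/
lemma rlp_of_isGAcyclic {T : ShortComplex (CochainComplex C ℤ)} (hT : T.ShortExact)
    (hg : IsGEpi G T.g) (h : IsGAcyclic G T.X₁) : (spheresToDisks G).rlp T.g := by
  rw [rlp_spheresToDisks_iff]
  intro n s z b hz hb
  have hs (k : ℤ) : (T.map (eval C (ComplexShape.up ℤ) k)).ShortExact := hT.map_of_exact _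
  have hm (k : ℤ) : Mono (T.f.f k) := (hs k).mono_f
  obtain ⟨y, hy⟩ := hg n s b
  -- An arbitrary lift y of b has the wrong differential; the error dy - z is a cycle of the kernel,
  -- hence some dv, and y - v is the solution.
  have hw : (y ≫ T.X₂.d n (n + 1) - z) ≫ T.g.f (n + 1) = 0 := by
    rw [Preadditive.sub_comp, Category.assoc, ← Hom.comm, reassoc_of% hy, hb, sub_self]
  have : Mono (T.map (eval C (ComplexShape.up ℤ) (n + 1))).f := hm (n + 1)
  let w : G s ⟶ T.X₁.X (n + 1) := (hs (n + 1)).exact.lift _ hw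
  have hwf : w ≫ T.f.f (n + 1) = y ≫ T.X₂.d n (n + 1) - z := (hs (n + 1)).exact.lift_f _ hw
  obtain ⟨v, hv⟩ := h n s w (by
    rw [← cancel_mono (T.f.f (n + 1 + 1)), Category.assoc, ← Hom.comm, reassoc_of% hwf,
      Preadditive.sub_comp, hz]
    simp)
  have hfg : T.f.f n ≫ T.g.f n = 0 := by rw [← comp_f, T.zero, zero_f]
  refine ⟨y - v ≫ T.f.f n, ?_, ?_⟩
  · rw [Preadditive.sub_comp, Category.assoc, Hom.comm, reassoc_of% hv, hwf]
    abel
  · rw [Preadditive.sub_comp, Category.assoc, hfg, comp_zero, sub_zero, hy]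

lemma isGAcyclic_of_rlp {T : ShortComplex (CochainComplex C ℤ)} (hT : T.ShortExact)
    (h : (spheresToDisks G).rlp T.g) : IsGAcyclic G T.X₁ := by
  rw [rlp_spheresToDisks_iff] at h
  intro n s z hz
  have hs (k : ℤ) : (T.map (eval C (ComplexShape.up ℤ) k)).ShortExact := hT.map_of_exact _
  have hm (k : ℤ) : Mono (T.f.f k) := (hs k).mono_f
  have hfg : T.f.f (n + 1) ≫ T.g.f (n + 1) = 0 := by rw [← comp_f, T.zero, zero_f]
  obtain ⟨x, hx, hx'⟩ := h n s (z ≫ T.f.f (n + 1)) 0 (by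
    rw [Category.assoc, Hom.comm, reassoc_of% hz, zero_comp]) (by simp [hfg])
  have : Mono (T.map (eval C (ComplexShape.up ℤ) n)).f := hm n
  let v : G s ⟶ T.X₁.X n := (hs n).exact.lift x hx'
  have hv : v ≫ T.f.f n = x := (hs n).exact.lift_f _ hx'
  exact ⟨v, by rw [← cancel_mono (T.f.f (n + 1)), Category.assoc, ← Hom.comm, reassoc_of% hv, hx]⟩

/-- The contracting homotopy applied to a cycle is a primitive of it. -/
lemma isGAcyclic_mappingCone_id (K : CochainComplex C ℤ) :
    IsGAcyclic G (CochainComplex.mappingCone (𝟙 K)) := by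
  intro n s z hz
  let H := CochainComplex.mappingCone.homotopyToZeroOfId K
  have h := H.comm (n + 1)
  rw [dNext_eq H.hom (show (ComplexShape.up ℤ).Rel (n + 1) (n + 1 + 1) from rfl),
    prevD_eq H.hom (show (ComplexShape.up ℤ).Rel n (n + 1) from rfl)] at h
  refine ⟨z ≫ H.hom (n + 1) n, ?_⟩
  have := z ≫= h
  rw [id_f, Category.comp_id, zero_f, add_zero, Preadditive.comp_add, reassoc_of% hz, zero_comp,
    zero_add] at this
  rw [Category.assoc, ← this]

/-- The inclusion of X in the cone of its identity extends along i, the cone being G-acyclic.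
Projecting back to X is possible in each degree but is not a chain map, so only degreewise
retractions result. -/
lemma exists_retraction_of_llp_rlp {X Y : CochainComplex C ℤ} {i : X ⟶ Y}
    (hi : (spheresToDisks G).rlp.llp i) (n : ℤ) : ∃ r, i.f n ≫ r = 𝟙 (X.X n) := by
  have := hi _ ((rlp_zero_iff _).2 (isGAcyclic_mappingCone_id X))
  have sq : CommSq (CochainComplex.mappingCone.inr (𝟙 X)) i
      (0 : CochainComplex.mappingCone (𝟙 X) ⟶ 0) 0 := ⟨by simp⟩
  refine ⟨sq.lift.f n ≫ (CochainComplex.mappingCone.snd (𝟙 X)).v n n (add_zero n), ?_⟩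
  rw [← Category.assoc, ← comp_f, sq.fac_left, CochainComplex.mappingCone.inr_f_snd_v]

lemma mono_of_llp_rlp {X Y : CochainComplex C ℤ} {i : X ⟶ Y}
    (hi : (spheresToDisks G).rlp.llp i) : Mono i :=
  mono_of_mono_f _ fun n => by
    obtain ⟨r, hr⟩ := exists_retraction_of_llp_rlp hi n
    exact mono_of_mono_fac hr

lemma llp_rlp_zero_disk (n : ℤ) (s : ι) :
    (spheresToDisks G).rlp.llp (0 : (0 : CochainComplex C ℤ) ⟶ disk n (G s)) := by
  intro X Y p hp
  refine ⟨fun {u v} sq => ?_⟩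
  obtain ⟨x, hx⟩ := isGEpi_of_rlp hp n s (diskι _ _ ≫ v.f n)
  exact ⟨⟨diskDesc x, (isZero_zero _).eq_of_src _ _, disk_hom_ext (by simp [hx])⟩⟩

/-- G-exactness lifts the generator of the cokernel, giving a map from D_n(G_s) to the middle term.
It exhibits the inflation as a pushout of 0 → D_n(G_s) or of S_{n+1}(G_s) → D_n(G_s), according to
the cokernel. -/
lemma inflationsWithCokernelIn_le_llp_rlp [HasCoproduct G] :
    inflationsWithCokernelIn (degreewiseGExact (∐ G)) (disksAndSpheres G) ≤
      (spheresToDisks G).rlp.llp := by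
  rintro X Y i ⟨_, p, w, hZ, hE⟩
  rw [degreewiseGExact_iff] at hE
  obtain ⟨hs, hp⟩ := hE
  have hi := hs.mono_f
  obtain ⟨n, s⟩ | ⟨n, s⟩ := hZ
  · obtain ⟨x, hx⟩ := hp n s (diskι n (G s))
    dsimp at hx
    have hx' : diskDesc x ≫ p = 𝟙 _ := disk_hom_ext (by simp [hx])
    let φ : ShortComplex.mk (0 : (0 : CochainComplex C ℤ) ⟶ disk n (G s)) (𝟙 _) zero_comp ⟶
        ShortComplex.mk i p w :=
      { τ₁ := 0, τ₂ := diskDesc x, τ₃ := 𝟙 _, comm₂₃ := by simp [hx'] }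
    have : IsIso φ.τ₃ := inferInstanceAs (IsIso (𝟙 _))
    exact MorphismProperty.of_isPushout (isPushout_of_shortExact φ (shortExact_zero_id _) hs)
      (llp_rlp_zero_disk n s)
  · obtain ⟨x, hx⟩ := hp n s (sphereι n (G s))
    dsimp at hx
    have hx' : diskDesc x ≫ p = diskToSphere n (G s) := disk_hom_ext (by simp [hx])
    have h₀ : (sphereToDisk n (G s) ≫ diskDesc x) ≫ p = 0 := by
      rw [Category.assoc, hx', sphereToDisk_diskToSphere]
    let h : sphere (n + 1) (G s) ⟶ X := hs.exact.lift _ h₀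
    have hh : h ≫ i = sphereToDisk n (G s) ≫ diskDesc x := hs.exact.lift_f _ h₀
    let φ : ShortComplex.mk _ _ (sphereToDisk_diskToSphere (n := n) (M := G s)) ⟶
        ShortComplex.mk i p w :=
      { τ₁ := h, τ₂ := diskDesc x, τ₃ := 𝟙 _, comm₁₂ := hh, comm₂₃ := by simp [hx'] }
    have : IsIso φ.τ₃ := inferInstanceAs (IsIso (𝟙 _))
    exact MorphismProperty.of_isPushout
      (isPushout_of_shortExact φ (shortExact_sphereToDisk n (G s)) hs)
      (MorphismProperty.le_llp_rlp _ _ ⟨(n, s)⟩)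

lemma subsingleton_yonedaExt_of_llp_rlp [HasCoproduct G] {X Y : CochainComplex C ℤ}
    (hX : (spheresToDisks G).rlp.llp (0 : 0 ⟶ X)) (hY : IsGAcyclic G Y) :
    Subsingleton (YonedaExt (degreewiseGExact (∐ G)) X Y) := by
  refine subsingleton_yonedaExt (fun T hT => hT.1) fun e => ?_
  have hE := (degreewiseGExact_iff _).1 e.exact
  have := hX _ (rlp_of_isGAcyclic hE.1 hE.2 hY)
  have sq : CommSq (0 : 0 ⟶ e.M) (0 : 0 ⟶ X) e.p (𝟙 X) := ⟨(isZero_zero _).eq_of_src _ _⟩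
  exact ⟨sq.lift, sq.fac_right⟩

lemma llp_rlp_zero_of_mem [HasCoproduct G] {X : CochainComplex C ℤ} (hX : disksAndSpheres G X) :
    (spheresToDisks G).rlp.llp (0 : 0 ⟶ X) := by
  exact inflationsWithCokernelIn_le_llp_rlp _ ⟨X, 𝟙 X, zero_comp, hX,
    (degreewiseGExact_iff _).2 ⟨shortExact_zero_id X, fun n s y => ⟨y, by simp⟩⟩⟩

theorem rightPerp_disksAndSpheres_iff [HasCoproduct G] (Y : CochainComplex C ℤ) :
    rightPerp (degreewiseGExact (∐ G)) (disksAndSpheres G) Y ↔ IsGAcyclic G Y := by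
  refine ⟨fun h n s z hz => ?_, fun h X hX =>
    subsingleton_yonedaExt_of_llp_rlp (llp_rlp_zero_of_mem hX) h⟩
  have := h _ (disksAndSpheres.sphere n s)
  -- A retraction of this pushout onto Y extends z to the disk, and the degree n element of the disk
  -- then gives the primitive of z.
  have sq := IsPushout.of_hasPushout (sphereDesc z hz) (sphereToDisk n (G s))
  obtain ⟨p, w, hp, hs⟩ := exists_shortExact_of_isPushout (shortExact_sphereToDisk n (G s)) sq
  have hE : degreewiseGExact (∐ G) (ShortComplex.mk _ p w) := by
    refine degreewiseGExact_of_comp _ hs (sphereToDisk n (G s)) (pushout.inr _ _) ?_ ?_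
    · simp [hp]
    · have := degreewiseGExact_sphereToDisk (G := G) n (G s)
      simpa only [hp] using this
  obtain ⟨t, ht⟩ := exists_section_of_subsingleton (degreewiseGExact_biprod (G := G)) ⟨_, _, p, w, hE⟩
  have := hs.mono_f
  let S := ShortComplex.Splitting.ofExactOfSection _ hs.exact t ht this
  have hr : pushout.inl (sphereDesc z hz) (sphereToDisk n (G s)) ≫ S.r = 𝟙 _ := S.f_r
  refine ⟨diskι n (G s) ≫ (pushout.inr (sphereDesc z hz) (sphereToDisk n (G s)) ≫ S.r).f n, ?_⟩
  rw [Category.assoc, Hom.comm, ← sphereι_sphereToDisk_assoc, ← comp_f, ← sq.w_assoc, hr,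
    Category.comp_id, sphereι_desc]

end GExact

/-! ### The small object argument and the two approximation sequences. -/

section Completeness

open HomologicalComplex HomotopicalAlgebra MorphismProperty

variable {C : Type u} [Category.{v} C] [Abelian C] [IsGrothendieckAbelian.{v} C] {ι : Type v}
  {G : ι → C}

instance hasSmallObjectArgument_spheresToDisks :
    HasSmallObjectArgument.{v} (spheresToDisks G) := by
  -- Smallness: κ exceeds the number of subobjects of each sphere involved, and the transition maps
  -- are monic, so Hom from these spheres preserves the colimits.
  obtain ⟨κ, hκ', hκ⟩ := HasCardinalLT.exists_regular_cardinal_forall.{v}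
    (fun a : ℤ × ι => Subobject (sphere (a.1 + 1) (G a.2)))
  have : Fact κ.IsRegular := ⟨hκ'⟩
  have : Nonempty κ.ord.ToType := by simpa using hκ'.ne_zero
  have := WellFoundedLT.toOrderBot κ.ord.ToType
  exact ⟨κ, inferInstance, inferInstance,
    { isSmall := by
        unfold spheresToDisks
        infer_instance
      preservesColimit {A B X Y} i hi f hf := by
        let hf' : (monomorphisms _).TransfiniteCompositionOfShape κ.ord.ToType f :=
          { toTransfiniteCompositionOfShape := hf.toTransfiniteCompositionOfShape
            map_mem j hj := by
              have h := (hf.attachCells j hj).pushouts_coproducts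
              simp only [ofHoms_homFamily] at h
              refine (?_ : _ ≤ monomorphisms _) _ h
              simp only [pushouts_le_iff, coproducts_le_iff]
              exact fun _ _ _ hi => mono_of_llp_rlp (le_llp_rlp _ _ hi) }
        have (j j' : κ.ord.ToType) (φ : j ⟶ j') : Mono (hf'.F.map φ) := hf'.mem_map φ
        obtain ⟨a⟩ := hi
        exact IsGrothendieckAbelian.preservesColimit_coyoneda_obj_of_mono hf'.F (hκ a) }⟩

lemma exists_factorization_with_cells {X Y : CochainComplex C ℤ} (f : X ⟶ Y) :
    ∃ (Z : CochainComplex C ℤ) (i : X ⟶ Z) (p : Z ⟶ Y) (J : Type v) (_ : LinearOrder J)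
      (_ : OrderBot J) (_ : SuccOrder J) (_ : WellFoundedLT J),
      Nonempty (RelativeCellComplex.{v} (fun _ : J => (spheresToDisks G).homFamily) i) ∧
      (spheresToDisks G).rlp.llp i ∧ (spheresToDisks G).rlp p ∧ i ≫ p = f := by
  obtain ⟨κ, _, _, _⟩ :=
    HasSmallObjectArgument.exists_cardinal.{v} (I := spheresToDisks G)
  exact ⟨_, SmallObject.ιObj (spheresToDisks G) κ f, SmallObject.πObj (spheresToDisks G) κ f,
    κ.ord.ToType, inferInstance, inferInstance, inferInstance, inferInstance,
    ⟨SmallObject.relativeCellComplexιObj _ κ f⟩, SmallObject.llp_rlp_ιObj _ κ f,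
    SmallObject.rlp_πObj _ κ f, SmallObject.ιObj_πObj _ κ f⟩

lemma filtered_of_spheresToDisks_cells {X : CochainComplex C ℤ} {f : 0 ⟶ X} {J : Type v}
    [LinearOrder J] [OrderBot J] [SuccOrder J] [WellFoundedLT J]
    (c : RelativeCellComplex.{v} (fun _ : J => (spheresToDisks G).homFamily) f) :
    filtered (degreewiseGExact (∐ G)) (disksAndSpheres G) X := by
  have key (a : (spheresToDisks G).toSet) :
      ∃ (Z : CochainComplex C ℤ) (q : a.1.right ⟶ Z) (w : (spheresToDisks G).homFamily a ≫ q = 0),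
        disksAndSpheres G Z ∧ degreewiseGExact (∐ G) (ShortComplex.mk _ _ w) := by
    obtain ⟨⟨A, B, i⟩, hi⟩ := a
    obtain ⟨n, s⟩ : spheresToDisks G i := hi
    exact ⟨_, diskToSphere n (G s), sphereToDisk_diskToSphere, disksAndSpheres.sphere n s,
      degreewiseGExact_sphereToDisk n (G s)⟩
  choose Z q w hZ hE using key
  refine filtered_of_relativeCellComplex _ _ degreewiseGExact_of_comp q w
    (fun a => (hE a).1) hE hZ c fun j => ?_
  let hc : (coproducts.{v} (spheresToDisks G)).pushouts.TransfiniteCompositionOfShape J f :=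
    c.transfiniteCompositionOfShape.ofLE (by simp)
  exact mono_of_llp_rlp (transfiniteCompositionsOfShape_pushouts_coproducts_le_llp_rlp
    -- The part of the complex from stage j on is again a transfinite composition of cell
    -- attachments, hence monic.
    (spheresToDisks G) (Set.Ici j) _ (hc.ici j).mem)

theorem exists_filtered_resolution (hG : (ObjectProperty.ofObj G).IsSeparating)
    (B : CochainComplex C ℤ) :
    ∃ (Y X : CochainComplex C ℤ) (i : Y ⟶ X) (p : X ⟶ B) (w : i ≫ p = 0),
      filtered (degreewiseGExact (∐ G)) (disksAndSpheres G) X ∧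
      IsGAcyclic G Y ∧ degreewiseGExact (∐ G) (ShortComplex.mk i p w) := by
  obtain ⟨F, i, p, J, _, _, _, _, ⟨c⟩, -, hp, -⟩ :=
    exists_factorization_with_cells (G := G) (0 : 0 ⟶ B)
  have hp' := isGEpi_of_rlp hp
  have := epi_of_isGEpi hG hp'
  have hs : (ShortComplex.mk _ _ (kernel.condition p)).ShortExact :=
    ShortComplex.ShortExact.mk' (ShortComplex.exact_kernel p) inferInstance this
  exact ⟨_, F, kernel.ι p, p, kernel.condition p, filtered_of_spheresToDisks_cells c,
    isGAcyclic_of_rlp hs hp, (degreewiseGExact_iff _).2 ⟨hs, hp'⟩⟩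

theorem exists_acyclic_embedding (B : CochainComplex C ℤ) :
    ∃ (Y X : CochainComplex C ℤ) (i : B ⟶ Y) (p : Y ⟶ X) (w : i ≫ p = 0),
      (spheresToDisks G).rlp.llp (0 : 0 ⟶ X) ∧
      IsGAcyclic G Y ∧ degreewiseGExact (∐ G) (ShortComplex.mk i p w) := by
  obtain ⟨Y, i, p, J, _, _, _, _, -, hi, hp, -⟩ :=
    exists_factorization_with_cells (G := G) (0 : B ⟶ 0)
  have := mono_of_llp_rlp hi
  have hs : (ShortComplex.mk _ _ (cokernel.condition i)).ShortExact :=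
    ShortComplex.ShortExact.mk' (ShortComplex.exact_cokernel i) this inferInstance
  obtain rfl : p = 0 := (isZero_zero _).eq_of_tgt _ _
  refine ⟨Y, _, i, cokernel.π i, cokernel.condition i, ?_, (rlp_zero_iff _).1 hp,
    degreewiseGExact_of_shortExact_of_retraction hs (exists_retraction_of_llp_rlp hi)⟩
  -- The map 0 → coker i is the pushout of i along B → 0, so it inherits the left lifting property.
  let φ : ShortComplex.mk _ _ (cokernel.condition i) ⟶
      ShortComplex.mk (0 : (0 : CochainComplex C ℤ) ⟶ cokernel i) (𝟙 _) zero_comp :=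
    { τ₁ := 0, τ₂ := cokernel.π i, τ₃ := 𝟙 _ }
  have : IsIso φ.τ₃ := inferInstanceAs (IsIso (𝟙 _))
  exact of_isPushout (isPushout_of_shortExact φ hs (shortExact_zero_id _)) hi

lemma llp_rlp_of_directSummands {X : CochainComplex C ℤ}
    (hX : directSummands (filtered (degreewiseGExact (∐ G)) (disksAndSpheres G)) X) :
    (spheresToDisks G).rlp.llp (0 : 0 ⟶ X) := by
  obtain ⟨F, W, hF, ⟨e⟩⟩ := hX
  have h : (spheresToDisks G).rlp.llp (0 : 0 ⟶ F) :=
    ((transfiniteCompositions_monotone inflationsWithCokernelIn_le_llp_rlp).trans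
      (transfiniteCompositions_le _)) _ hF
  refine of_retract ?_ h
  exact
    { i := Arrow.homMk (𝟙 _) (biprod.inl ≫ e.inv) ((isZero_zero _).eq_of_src _ _)
      r := Arrow.homMk (𝟙 _) (e.hom ≫ biprod.fst) ((isZero_zero _).eq_of_src _ _) }

end Completeness

end RelativeCotorsion

end

theorem corollary4p2 {C : Type u} [Category.{v} C] [Abelian C] [IsGrothendieckAbelian.{v} C]
    {ι : Type v} (G : ι → C) (hG : (ObjectProperty.ofObj G).IsSeparating) :
    RelativeCotorsion.IsCompleteCotorsionPair
      (RelativeCotorsion.degreewiseGExact (∐ G))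
      (RelativeCotorsion.leftPerp (RelativeCotorsion.degreewiseGExact (∐ G))
        (RelativeCotorsion.rightPerp (RelativeCotorsion.degreewiseGExact (∐ G))
          (RelativeCotorsion.disksAndSpheres G)))
      (RelativeCotorsion.rightPerp (RelativeCotorsion.degreewiseGExact (∐ G))
        (RelativeCotorsion.disksAndSpheres G)) ∧
    RelativeCotorsion.leftPerp (RelativeCotorsion.degreewiseGExact (∐ G))
        (RelativeCotorsion.rightPerp (RelativeCotorsion.degreewiseGExact (∐ G))
          (RelativeCotorsion.disksAndSpheres G)) =
      RelativeCotorsion.directSummands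
        (RelativeCotorsion.filtered (RelativeCotorsion.degreewiseGExact (∐ G))
          (RelativeCotorsion.disksAndSpheres G)) := by
  open RelativeCotorsion in
  have hleft {X : CochainComplex C ℤ}
      (hX : (spheresToDisks G).rlp.llp (0 : 0 ⟶ X)) :
      leftPerp (degreewiseGExact (∐ G))
        (rightPerp (degreewiseGExact (∐ G)) (disksAndSpheres G)) X := fun Y hY =>
    subsingleton_yonedaExt_of_llp_rlp hX ((rightPerp_disksAndSpheres_iff Y).1 hY)
  have hsummand {X : CochainComplex C ℤ}
      (hX : directSummands (filtered (degreewiseGExact (∐ G)) (disksAndSpheres G)) X) :=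
    hleft (llp_rlp_of_directSummands hX)
  refine ⟨⟨rfl, ?_, fun B => ?_, fun B => ?_⟩, ?_⟩
  · exact le_antisymm (fun Y hY X hX => hX Y hY)
      fun Y hY X hX => hY X (hleft (llp_rlp_zero_of_mem hX))
  · obtain ⟨Y, X, i, p, w, hX, hY, hE⟩ := exists_filtered_resolution hG B
    exact ⟨Y, X, i, p, w, hsummand ⟨X, 0, hX, ⟨isoBiprodZero (isZero_zero _)⟩⟩, (rightPerp_disksAndSpheres_iff Y).2 hY, hE⟩
  · obtain ⟨Y, X, i, p, w, hX, hY, hE⟩ := exists_acyclic_embedding (G := G) B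
    exact ⟨Y, X, i, p, w, hleft hX, (rightPerp_disksAndSpheres_iff Y).2 hY, hE⟩
  · refine le_antisymm (fun X hX => ?_) fun X hX => hsummand hX
    -- The kernel Y is G-acyclic, so Ext¹(X, Y) = 0 splits this resolution and F ≅ X ⊞ Y.
    obtain ⟨Y, F, i, p, w, hF, hY, hE⟩ := exists_filtered_resolution hG X
    have := hX Y ((rightPerp_disksAndSpheres_iff Y).2 hY)
    obtain ⟨t, ht⟩ := exists_section_of_subsingleton (degreewiseGExact_biprod (G := G))
      ⟨F, i, p, w, hE⟩
    have := hE.1.mono_f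
    let S := ShortComplex.Splitting.ofExactOfSection _ hE.1.exact t ht this
    exact ⟨F, Y, hF, ⟨S.isoBinaryBiproduct ≪≫ biprod.braiding _ _⟩⟩
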